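/- Let $R$ be a commutative noetherian ring, $\mathfrak{a}$ an ideal of $R$, $M$ and $N$ finitely generated $R$-modules, and $n\ge 0$ an integer. For $i\ge 0$ let $$H^i_{\mathfrak{a}}(M,N)=\varinjlim_{t}\operatorname{Ext}^i_R(M/\mathfrak{a}^tM,N)$$ be the $i$-th generalized local cohomology module, the transition maps being induced by the canonical surjections $M/\mathfrak{a}^{t+1}M\to M/\mathfrak{a}^{t}M$. An $R$-module $H$ is called coatomic if each proper submodule of $H$ is contained in a maximal submodule of $H$. Let $\operatorname{Coass}_R(H)$ denote the set of prime ideals $\mathfrak{p}$ of $R$ such that $\mathfrak{p}=\operatorname{Ann}_R(H/U)$ for some submodule $U$ of $H$ with $H/U$ artinian, and let $V(\mathfrak{a})$ denote the set of prime ideals of $R$ containing $\mathfrak{a}$. Then the following statements are equivalent: (i) $H^i_{\mathfrak{a}}(M,N)$ is coatomic for all $i<n$; (ii) $\operatorname{Coass}_R(H^i_{\mathfrak{a}}(M,N))\subseteq V(\mathfrak{a})$ for all $i<n$; (iii) $H^i_{\mathfrak{a}}(M,N)$ is finitely generated for all $i<n$. -/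

import Mathlib

universe u

open CategoryTheory

noncomputable section

namespace GenLocalCohomology

variable {R : Type u} [CommRing R]

/-- The canonical surjection `M / 𝔞 ^ t M → M / 𝔞 ^ s M` for `s ≤ t`. -/
def quotPowMap (𝔞 : Ideal R) (M : Type u) [AddCommGroup M] [Module R M] {s t : ℕ} (h : s ≤ t) :
    (M ⧸ (𝔞 ^ t • ⊤ : Submodule R M)) →ₗ[R] (M ⧸ (𝔞 ^ s • ⊤ : Submodule R M)) :=
  Submodule.factor (Submodule.smul_mono_left (Ideal.pow_le_pow_right h))

/-- The module `Ext^i_R(M / 𝔞 ^ t M, N)`. -/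
abbrev extQuotPow (𝔞 : Ideal R) (M N : Type u) [AddCommGroup M] [Module R M]
    [AddCommGroup N] [Module R N] (i t : ℕ) : Type u :=
  Abelian.Ext (ModuleCat.of R (M ⧸ (𝔞 ^ t • ⊤ : Submodule R M))) (ModuleCat.of R N) i

/-- For `s ≤ t`, the map `Ext^i_R(M / 𝔞 ^ s M, N) → Ext^i_R(M / 𝔞 ^ t M, N)` induced by the
canonical surjection `M / 𝔞 ^ t M → M / 𝔞 ^ s M`. -/
def extQuotPowMap (𝔞 : Ideal R) (M N : Type u) [AddCommGroup M] [Module R M]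
    [AddCommGroup N] [Module R N] (i s t : ℕ) (h : s ≤ t) :
    extQuotPow 𝔞 M N i s →ₗ[R] extQuotPow 𝔞 M N i t :=
  (Abelian.Ext.mk₀ (ModuleCat.ofHom (quotPowMap 𝔞 M h))).precompOfLinear R
    (ModuleCat.of R N) (zero_add i)

instance instDirectedSystemExtQuotPow (𝔞 : Ideal R) (M N : Type u) [AddCommGroup M] [Module R M]
    [AddCommGroup N] [Module R N] (i : ℕ) :
    DirectedSystem (extQuotPow 𝔞 M N i) (fun s t h => extQuotPowMap 𝔞 M N i s t h) where
  map_self s x := by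
    have : quotPowMap 𝔞 M (le_refl s) = LinearMap.id := by
      ext; rfl
    simp [extQuotPowMap, this]
  map_map r s t hrs hst x := by
    have : ModuleCat.ofHom (quotPowMap 𝔞 M (hrs.trans hst)) =
        ModuleCat.ofHom (quotPowMap 𝔞 M hst) ≫ ModuleCat.ofHom (quotPowMap 𝔞 M hrs) := by
      ext; rfl
    simp only [extQuotPowMap, this, ← Abelian.Ext.mk₀_comp_mk₀,
      Abelian.Ext.bilinearCompOfLinear_apply_apply, Abelian.Ext.mk₀_comp_mk₀_assoc]

/-- The generalized local cohomology module
`H^i_𝔞(M, N) = colim_t Ext^i_R(M / 𝔞 ^ t M, N)`. -/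
abbrev genLocalCohomology (𝔞 : Ideal R) (i : ℕ) (M N : Type u) [AddCommGroup M] [Module R M]
    [AddCommGroup N] [Module R N] : Type u :=
  Module.DirectLimit (extQuotPow 𝔞 M N i) (extQuotPowMap 𝔞 M N i)

/-- An `R`-module is coatomic if each proper submodule is contained in a maximal submodule. -/
def IsCoatomicModule (R : Type u) [CommRing R] (H : Type u) [AddCommGroup H] [Module R H] :
    Prop :=
  ∀ U : Submodule R H, U ≠ ⊤ → ∃ V : Submodule R H, IsCoatom V ∧ U ≤ V

/-- The set of coassociated primes of `H`: the primes of the form `Ann_R(H / U)` where `U` is a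
submodule of `H` such that `H / U` is artinian. -/
def coass (R : Type u) [CommRing R] (H : Type u) [AddCommGroup H] [Module R H] :
    Set (PrimeSpectrum R) :=
  {p | ∃ U : Submodule R H, IsArtinian R (H ⧸ U) ∧ Module.annihilator R (H ⧸ U) = p.asIdeal}

end GenLocalCohomology

end

/-! Finitely generated modules are coatomic, and those on which a power of 𝔞 vanishes have Coass
inside V(𝔞). For the converses, induct on i. If all lower modules are finitely generated,
`fg_idealColon_genLocalCohomology` makes (0 :_H 𝔞) finitely generated for H = H^i_𝔞(M, N). As H is
𝔞-torsion, Ass H is then finite, and H is finitely generated once each x ∈ 𝔞 has a power killing H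
(`finite_of_forall_exists_pow_smul_eq_zero`).

If no power of x kills H, `exists_artinian_quotient_smul_surjective` gives a nonzero artinian
quotient on which x is surjective. A coatomic H would then have a simple quotient on which x is both
bijective and torsion; and such a quotient has a coassociated prime avoiding x. Both hypotheses
exclude this. The quotient is the image of a map to an artinian cogenerator at a maximal ideal.

The socle statement is a noetherian induction on quotients of M: divide out either (0 :_M 𝔞) or xM
for a nonzerodivisor x ∈ 𝔞, using the parts of the long exact sequence that Artin–Rees provides. -/

noncomputable section

namespace GenLocalCohomology

/-! ### Artinian cogenerators at a maximal ideal -/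

section Cogenerator

variable {R : Type u} [CommRing R]

/-- `E` cogenerates at `𝔪`: every element whose annihilator lies in `𝔪` is detected by a map to
`E`. -/
def CogeneratesAt (𝔪 : Ideal R) (E : Type u) [AddCommGroup E] [Module R E] : Prop :=
  ∀ (X : Type u) [AddCommGroup X] [Module R X] (w : X), (∀ r : R, r • w = 0 → r ∈ 𝔪) →
    ∃ φ : X →ₗ[R] E, φ w ≠ 0

/-- The elements of the Rees algebra of `𝔪` annihilating the layers of the filtration of `U` by
the submodules killed by powers of `𝔪`. -/
def layerAnnihilator (𝔪 : Ideal R) {E : Type u} [AddCommGroup E] [Module R E]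
    (U : Submodule R E) : Ideal (reesAlgebra 𝔪) where
  carrier := {f | ∀ t, ∀ u ∈ U, (∀ a ∈ 𝔪 ^ (t + 1), a • u = 0) →
    (f : Polynomial R).coeff t • u = 0}
  add_mem' := by
    intro f g hf hg t u hu h
    simp [add_smul, hf t u hu h, hg t u hu h]
  zero_mem' := by
    intro t u _ _
    simp
  smul_mem' := by
    intro g f hf t u hu h
    simp only [smul_eq_mul, Subalgebra.coe_mul, Polynomial.coeff_mul, Finset.sum_smul]
    refine Finset.sum_eq_zero fun ij hij => ?_
    rw [mul_comm, mul_smul]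
    refine hf _ _ (U.smul_mem _ hu) fun a ha => ?_
    rw [smul_smul]
    refine h _ ?_
    have h1 : ij.2 + 1 + ij.1 = t + 1 := by
      have := Finset.HasAntidiagonal.mem_antidiagonal.1 hij
      omega
    rw [← h1, pow_add]
    exact Ideal.mul_mem_mul ha (g.2 ij.1)

lemma layerAnnihilator_anti (𝔪 : Ideal R) {E : Type u} [AddCommGroup E] [Module R E]
    {U V : Submodule R E} (h : U ≤ V) : layerAnnihilator 𝔪 V ≤ layerAnnihilator 𝔪 U :=
  fun _ hf t u hu => hf t u (h hu)

variable [IsNoetherianRing R] {𝔪 : Ideal R} [h𝔪 : 𝔪.IsMaximal]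
  {E : Type u} [AddCommGroup E] [Module R E]

/-- If V had an element outside U, a functional would separate the two in some layer. As the socle
is cyclic, that functional acts on the layer as a scalar b ∈ 𝔪 ^ t, so b Tᵗ annihilates the layer of
U but not that of V. -/
lemma le_of_layerAnnihilator_le (hE : CogeneratesAt 𝔪 E)
    (htors : ∀ e : E, ∃ t, ∀ a ∈ 𝔪 ^ t, a • e = 0) (s₀ : E)
    (hs₀ : ∀ e : E, (∀ a ∈ 𝔪, a • e = 0) → ∃ r : R, e = r • s₀) (hms₀ : ∀ a ∈ 𝔪, a • s₀ = 0)
    {U V : Submodule R E} (hUV : U ≤ V)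
    (h : layerAnnihilator 𝔪 U ≤ layerAnnihilator 𝔪 V) : V ≤ U := by
  suffices H : ∀ t, ∀ v ∈ V, (∀ a ∈ 𝔪 ^ t, a • v = 0) → v ∈ U by
    intro v hv
    obtain ⟨t, ht⟩ := htors v
    exact H t v hv ht
  intro t
  induction t with
  | zero =>
    intro v _ h0
    have : v = 0 := by simpa using h0 1 (by simp)
    simp [this]
  | succ t ih =>
    intro v hv hvt
    obtain ⟨n, a, ha⟩ := Submodule.fg_iff_exists_fin_generating_family.1
      (IsNoetherian.noetherian (𝔪 ^ t : Ideal R))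
    have ham : ∀ i, a i ∈ 𝔪 ^ t := fun i => by
      rw [← ha]; exact Submodule.subset_span ⟨i, rfl⟩
    -- The kernel of `ev` is the part killed by 𝔪 ^ t, and `ev` sends `F` into a power of the socle.
    let ev : E →ₗ[R] (Fin n → E) := LinearMap.pi fun i => a i • LinearMap.id
    let F : Submodule R E :=
      { carrier := {e | ∀ b ∈ 𝔪 ^ (t + 1), b • e = 0}
        add_mem' := fun h1 h2 b hb => by rw [smul_add, h1 b hb, h2 b hb, add_zero]
        zero_mem' := fun b _ => smul_zero b
        smul_mem' := fun r e h1 b hb => by rw [smul_comm, h1 b hb, smul_zero] }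
    let P : Submodule R (Fin n → E) := (U ⊓ F).map ev
    have hsoc : ∀ e ∈ F, ∀ c ∈ 𝔪 ^ t, ∃ r : R, c • e = r • s₀ := fun e he c hc =>
      hs₀ _ fun b hb => by
        rw [smul_smul]
        exact he _ (by rw [pow_succ']; exact Ideal.mul_mem_mul hb hc)
    by_cases hw : ev v ∈ P
    · obtain ⟨y, ⟨hyU, hyF⟩, hy⟩ := hw
      have hmem : v - y ∈ U := by
        refine ih _ (V.sub_mem hv (hUV hyU)) fun b hb => ?_
        rw [← ha] at hb
        induction hb using Submodule.span_induction with
        | mem b hb =>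
          obtain ⟨i, rfl⟩ := hb
          have := congrFun hy i
          simp only [ev, LinearMap.pi_apply, LinearMap.smul_apply, LinearMap.id_apply] at this
          rw [smul_sub, this, sub_self]
        | zero => simp
        | add b c _ _ hb hc => rw [add_smul, hb, hc, add_zero]
        | smul r b _ hb => rw [smul_eq_mul, mul_smul, hb, smul_zero]
      simpa using U.add_mem hmem hyU
    · exfalso
      -- 𝔪 kills `ev v`, so a scalar outside 𝔪, being invertible mod 𝔪, cannot move it into `P`.
      obtain ⟨φ, hφ⟩ := hE ((Fin n → E) ⧸ P) (P.mkQ (ev v)) (by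
        intro r hr
        by_contra hrm
        obtain ⟨y, z, hz, hyz⟩ := h𝔪.exists_inv hrm
        apply hw
        rw [← map_smul, Submodule.mkQ_apply, Submodule.Quotient.mk_eq_zero] at hr
        have hzv : z • ev v = 0 := by
          ext i
          simp only [ev, LinearMap.pi_apply, Pi.smul_apply, LinearMap.smul_apply,
            LinearMap.id_apply, Pi.zero_apply, smul_smul]
          exact hvt _ (by rw [pow_succ']; exact Ideal.mul_mem_mul hz (ham i))
        have : ev v = y • r • ev v := by
          conv_lhs => rw [← one_smul R (ev v), ← hyz, add_smul, hzv, add_zero, mul_smul]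
        rw [this]
        exact P.smul_mem _ hr)
      let f : (Fin n → E) →ₗ[R] E := φ ∘ₗ P.mkQ
      have hc : ∀ i, ∃ c : R, f (Pi.single i s₀) = c • s₀ := fun i => by
        refine hs₀ _ fun b hb => ?_
        rw [← map_smul, ← Pi.single_smul, hms₀ b hb, Pi.single_zero, map_zero]
      choose c hc using hc
      have hf : ∀ e ∈ F, f (ev e) = (∑ i, c i * a i) • e := by
        intro e he
        rw [Finset.sum_smul, ← Finset.univ_sum_single (ev e), map_sum]
        refine Finset.sum_congr rfl fun i _ => ?_
        obtain ⟨r, hr⟩ := hsoc e he (a i) (ham i)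
        have : ev e i = r • s₀ := hr
        rw [mul_smul, hr, this, Pi.single_smul, map_smul, hc, smul_comm]
      have hb : ∑ i, c i * a i ∈ 𝔪 ^ t :=
        Ideal.sum_mem _ fun i _ => Ideal.mul_mem_left _ _ (ham i)
      have hmem : (⟨Polynomial.monomial t (∑ i, c i * a i), reesAlgebra.monomial_mem.2 hb⟩ :
          reesAlgebra 𝔪) ∈ layerAnnihilator 𝔪 U := by
        intro t' u hu hut
        simp only [Polynomial.coeff_monomial]
        split_ifs with htt
        · subst htt
          rw [← hf u hut]
          change φ (P.mkQ (ev u)) = 0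
          rw [Submodule.mkQ_apply, (Submodule.Quotient.mk_eq_zero P).2 ⟨u, ⟨hu, hut⟩, rfl⟩, map_zero]
        · exact zero_smul _ _
      have := h hmem t v hv hvt
      simp only [Polynomial.coeff_monomial, if_true] at this
      exact hφ ((hf v hvt).trans this)

/-- `layerAnnihilator` is strictly order-reversing into the ideals of the Rees algebra, which is
noetherian. -/
lemma CogeneratesAt.isArtinian (hE : CogeneratesAt 𝔪 E)
    (htors : ∀ e : E, ∃ t, ∀ a ∈ 𝔪 ^ t, a • e = 0) (s₀ : E)
    (hs₀ : ∀ e : E, (∀ a ∈ 𝔪, a • e = 0) → ∃ r : R, e = r • s₀) (hms₀ : ∀ a ∈ 𝔪, a • s₀ = 0) :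
    IsArtinian R E := by
  have hlt : ∀ U V : Submodule R E, U < V → layerAnnihilator 𝔪 V < layerAnnihilator 𝔪 U :=
    fun U V hUV => lt_of_le_not_ge (layerAnnihilator_anti 𝔪 hUV.le) fun h =>
      hUV.not_ge (le_of_layerAnnihilator_le hE htors s₀ hs₀ hms₀ hUV.le h)
  refine ⟨?_⟩
  have wf : WellFounded fun I J : Ideal (reesAlgebra 𝔪) => I > J := wellFounded_gt
  exact Subrelation.wf (fun {U V} h => hlt U V h)
    (InvImage.wf (layerAnnihilator (E := E) 𝔪) wf)

variable (𝔪) in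
-- Embed R/𝔪 in an injective I and divide by a submodule maximal among those missing the image s of
-- 1. Every nonzero element of the quotient then has s as a multiple, so the socle is Rs, and maps
-- to I sending w to s still detect w.
lemma exists_isArtinian_cogenerator :
    ∃ (E : Type u) (_ : AddCommGroup E) (_ : Module R E), IsArtinian R E ∧ CogeneratesAt 𝔪 E := by
  obtain ⟨⟨I, hI, j, hj⟩⟩ := EnoughInjectives.presentation (ModuleCat.of R (R ⧸ 𝔪))
  have hIinj : Module.Injective R I := Module.injective_module_of_injective_object R I
  have hjinj : Function.Injective j.hom := (ModuleCat.mono_iff_injective j).1 hj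
  let s : I := j.hom (Ideal.Quotient.mk 𝔪 1)
  have hrs : ∀ r : R, r • s = 0 ↔ r ∈ 𝔪 := fun r => by
    change r • j.hom _ = 0 ↔ _
    rw [← map_smul, map_eq_zero_iff _ hjinj, ← Ideal.Quotient.eq_zero_iff_mem]
    change Ideal.Quotient.mk 𝔪 (r * 1) = 0 ↔ _
    rw [mul_one]
  obtain ⟨U, hU⟩ := zorn_le_nonempty₀ {U : Submodule R I | s ∉ U} (by
    intro c hc hchain y hy
    refine ⟨sSup c, ?_, fun z hz => le_sSup hz⟩
    intro hs
    rw [Submodule.mem_sSup_of_directed ⟨y, hy⟩ hchain.directedOn] at hs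
    obtain ⟨z, hz, hsz⟩ := hs
    exact hc hz hsz) ⊥ (by
      intro h
      have : (1 : R) ∈ 𝔪 := (hrs 1).1 (by simpa using h)
      exact h𝔪.ne_top ((Ideal.eq_top_iff_one _).2 this))
  obtain ⟨-, hsU, hmax⟩ := hU
  have hess : ∀ e : I ⧸ U, e ≠ 0 → ∃ r : R, r • e = U.mkQ s := by
    intro e he
    obtain ⟨e, rfl⟩ := U.mkQ_surjective e
    have : s ∈ U ⊔ Submodule.span R {e} := by
      by_contra hs
      have := hmax (y := U ⊔ Submodule.span R {e}) hs le_sup_left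
      apply he
      rw [Submodule.mkQ_apply, Submodule.Quotient.mk_eq_zero]
      exact this (Submodule.mem_sup_right (Submodule.mem_span_singleton_self e))
    obtain ⟨y, hy, z, hz, hyz⟩ := Submodule.mem_sup.1 this
    obtain ⟨r, rfl⟩ := Submodule.mem_span_singleton.1 hz
    refine ⟨r, ?_⟩
    rw [← map_smul, ← hyz, map_add, (by simpa using hy : U.mkQ y = 0), zero_add]
  have hs0 : U.mkQ s ≠ 0 := by simpa using hsU
  have hms : ∀ a ∈ 𝔪, a • U.mkQ s = 0 := fun a ha => by rw [← map_smul, (hrs a).2 ha, map_zero]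
  have hcog : CogeneratesAt 𝔪 (I ⧸ U) := by
    intro X _ _ w hw
    let g : (R ⧸ LinearMap.ker (LinearMap.toSpanSingleton R X w)) →ₗ[R] I :=
      Submodule.liftQ _ (LinearMap.toSpanSingleton R I s) (fun r hr => by
        simp only [LinearMap.mem_ker, LinearMap.toSpanSingleton_apply] at hr ⊢
        exact (hrs r).2 (hw r hr))
    let i : (R ⧸ LinearMap.ker (LinearMap.toSpanSingleton R X w)) →ₗ[R] X :=
      Submodule.liftQ _ (LinearMap.toSpanSingleton R X w) le_rfl
    have hi : Function.Injective i := by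
      rw [← LinearMap.ker_eq_bot]
      exact Submodule.ker_liftQ_eq_bot' _ _ rfl
    obtain ⟨φ, hφ⟩ := Module.Injective.extension_property R I _ _ i hi g
    refine ⟨U.mkQ ∘ₗ φ, ?_⟩
    have h1 : φ w = s := by
      have := LinearMap.congr_fun hφ (Submodule.Quotient.mk 1)
      simpa only [i, g, LinearMap.comp_apply, Submodule.liftQ_apply,
        LinearMap.toSpanSingleton_apply, one_smul] using this
    simpa only [LinearMap.comp_apply, h1] using hs0
  refine ⟨I ⧸ U, inferInstance, inferInstance, ?_, hcog⟩
  refine hcog.isArtinian (fun e => ?_) (U.mkQ s) (fun e he => ?_) hms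
  -- Artin–Rees: 𝔪 ^ (k+1) e meets Rs inside 𝔪 s = 0, while any nonzero element has s as a multiple.
  · obtain ⟨k, hk⟩ := Ideal.exists_pow_inf_eq_pow_smul (M := Submodule.span R {e}) 𝔪
      ((Submodule.span R {U.mkQ s}).comap (Submodule.span R {e}).subtype)
    refine ⟨k + 1, fun a ha => ?_⟩
    by_contra hne
    obtain ⟨r, hr⟩ := hess _ hne
    let y : Submodule.span R {e} := (r * a) • ⟨e, Submodule.mem_span_singleton_self e⟩
    have hy : (y : I ⧸ U) = U.mkQ s := by
      rw [← hr, smul_smul]; rfl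
    have hmem : y ∈ (𝔪 ^ (k + 1) • ⊤ : Submodule R (Submodule.span R {e})) ⊓
        (Submodule.span R {U.mkQ s}).comap (Submodule.span R {e}).subtype := by
      refine ⟨Submodule.smul_mem_smul (Ideal.mul_mem_left _ _ ha) trivial, ?_⟩
      change (y : I ⧸ U) ∈ Submodule.span R {U.mkQ s}
      rw [hy]
      exact Submodule.mem_span_singleton_self _
    rw [hk _ (Nat.le_succ k), Nat.succ_eq_add_one, Nat.add_sub_cancel_left, pow_one] at hmem
    have : y = 0 := by
      refine Submodule.smul_induction_on hmem (fun b hb z hz => ?_) (fun z z' hz hz' => ?_)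
      · obtain ⟨c, hc⟩ := Submodule.mem_span_singleton.1 (show (z : I ⧸ U) ∈ _ from hz.2)
        ext
        rw [Submodule.coe_smul, ← hc, smul_comm, hms b hb, smul_zero, Submodule.coe_zero]
      · rw [hz, hz', add_zero]
    apply hs0
    rw [← hy, this, Submodule.coe_zero]
  · by_cases he0 : e = 0
    · exact ⟨0, by rw [he0, zero_smul]⟩
    · obtain ⟨r, hr⟩ := hess e he0
      have hrm : r ∉ 𝔪 := fun h => hs0 (by rw [← hr, he r h])
      obtain ⟨y, z, hz, hyz⟩ := h𝔪.exists_inv hrm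
      refine ⟨y, ?_⟩
      conv_lhs => rw [← one_smul R e, ← hyz, add_smul, he z hz, add_zero, mul_smul, hr]

end Cogenerator

/-! ### Artinian quotients of torsion modules and coassociated primes -/

section Torsion

variable {R : Type u} [CommRing R] {H : Type u} [AddCommGroup H] [Module R H]
  {E : Type u} [AddCommGroup E] [Module R E]

/-- On an `x`-torsion module, if no power of `x` kills all maps to `E`, then some single map to
`E` is not killed by any power of `x`. -/
lemma exists_hom_forall_pow_smul_ne_zero (x : R) (htors : ∀ h : H, ∃ t, x ^ t • h = 0)
    (hφ : ∀ k, ∃ (φ : H →ₗ[R] E) (h : H), φ (x ^ k • h) ≠ 0) :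
    ∃ φ : H →ₗ[R] E, ∀ k, ∃ h, φ (x ^ k • h) ≠ 0 := by
  -- A pair (σ, t) is a map to be frozen on the x ^ t-torsion. Adding x ^ t • φ leaves it unchanged
  -- there; the new exponent also freezes the value at the witness. The maps have a limit because H
  -- is x-torsion.
  have step : ∀ (j : ℕ) (p : (H →ₗ[R] E) × ℕ), ∃ (q : (H →ₗ[R] E) × ℕ) (h : H),
      (∀ y, x ^ p.2 • y = 0 → q.1 y = p.1 y) ∧ p.2 + 1 ≤ q.2 ∧ x ^ q.2 • h = 0 ∧
        q.1 (x ^ j • h) ≠ 0 := by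
    rintro j ⟨σ, t⟩
    have key : ∃ (σ' : H →ₗ[R] E) (h : H), (∀ y, x ^ t • y = 0 → σ' y = σ y) ∧
        σ' (x ^ j • h) ≠ 0 := by
      by_cases hσ : ∃ h, σ (x ^ j • h) ≠ 0
      · obtain ⟨h, hh⟩ := hσ
        exact ⟨σ, h, fun _ _ => rfl, hh⟩
      · push Not at hσ
        obtain ⟨φ, h, hh⟩ := hφ (t + j)
        refine ⟨σ + x ^ t • φ, h, fun y hy => ?_, ?_⟩
        · rw [LinearMap.add_apply, LinearMap.smul_apply, ← map_smul, hy, map_zero, add_zero]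
        · rwa [LinearMap.add_apply, hσ, zero_add, LinearMap.smul_apply, ← map_smul, smul_smul,
            ← pow_add]
    obtain ⟨σ', h, h1, h2⟩ := key
    obtain ⟨s, hs⟩ := htors h
    refine ⟨(σ', t + 1 + s), h, h1, ?_, ?_, h2⟩
    · dsimp only
      omega
    · dsimp only
      rw [pow_add, mul_smul, hs, smul_zero]
  choose nxt wit hnxt hle hwit hne using step
  let seq : ℕ → (H →ₗ[R] E) × ℕ := fun j => Nat.rec (0, 0) (fun i p => nxt i p) j
  have hseq : ∀ j, seq (j + 1) = nxt j (seq j) := fun _ => rfl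
  have hge : ∀ j, j ≤ (seq j).2 := by
    intro j
    induction j with
    | zero => exact Nat.zero_le _
    | succ j ih =>
      have := hle j (seq j)
      rw [hseq]
      omega
  have hmono : ∀ i j, i ≤ j → (seq i).2 ≤ (seq j).2 := by
    intro i j hij
    induction hij with
    | refl => exact le_rfl
    | step _ ih =>
      refine ih.trans ?_
      rw [Nat.succ_eq_add_one, hseq]
      exact (Nat.le_succ _).trans (hle _ _)
  have hstab : ∀ i j, i ≤ j → ∀ y, x ^ (seq i).2 • y = 0 → (seq j).1 y = (seq i).1 y := by
    intro i j hij y hy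
    induction hij with
    | refl => rfl
    | @step m hm ih =>
      rw [Nat.succ_eq_add_one, hseq, hnxt _ _ y, ih]
      rw [← Nat.sub_add_cancel (hmono i m hm), pow_add, mul_smul, hy, smul_zero]
  have hkill : ∀ y : H, ∃ i, x ^ (seq i).2 • y = 0 := fun y => by
    obtain ⟨t, ht⟩ := htors y
    exact ⟨t, by rw [← Nat.sub_add_cancel (hge t), pow_add, mul_smul, ht, smul_zero]⟩
  choose N hN using hkill
  have hval : ∀ y j, N y ≤ j → (seq (N y)).1 y = (seq j).1 y := fun y j hj =>
    (hstab _ _ hj y (hN y)).symm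
  refine ⟨{ toFun := fun y => (seq (N y)).1 y, map_add' := fun y z => ?_,
            map_smul' := fun r y => ?_ }, fun k => ⟨wit k (seq k), ?_⟩⟩
  · rw [hval _ (N y + N z + N (y + z)) (by omega), hval y (N y + N z + N (y + z)) (by omega),
      hval z (N y + N z + N (y + z)) (by omega), map_add]
  · rw [RingHom.id_apply, hval _ (N y + N (r • y)) (by omega), hval y (N y + N (r • y)) (by omega),
      map_smul]
  · change (seq (N (x ^ k • wit k (seq k)))).1 (x ^ k • wit k (seq k)) ≠ 0
    rw [hval _ (N (x ^ k • wit k (seq k)) + (k + 1)) (by omega),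
      hstab (k + 1) _ (by omega), hseq]
    · exact hne k (seq k)
    · rw [smul_comm, hseq, hwit, smul_zero]

variable [IsNoetherianRing R]

/-- An `x`-torsion module with finitely many associated primes which is not killed by a power of
`x` has a nonzero artinian quotient on which `x` is surjective. -/
lemma exists_artinian_quotient_smul_surjective (x : R) (htors : ∀ h : H, ∃ t, x ^ t • h = 0)
    (hass : (associatedPrimes R H).Finite) (hx : ¬ ∃ k, ∀ h : H, x ^ k • h = 0) :
    ∃ U : Submodule R H, U ≠ ⊤ ∧ IsArtinian R (H ⧸ U) ∧
      ∀ q : H ⧸ U, ∃ q', q = x • q' := by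
  have hcog : ∀ p : Ideal R, ∃ (E : Type u) (_ : AddCommGroup E) (_ : Module R E),
      IsArtinian R E ∧ (p.IsPrime → ∃ 𝔪, p ≤ 𝔪 ∧ CogeneratesAt 𝔪 E) := by
    intro p
    by_cases hp : p.IsPrime
    · obtain ⟨𝔪, h𝔪, hle⟩ := p.exists_le_maximal hp.ne_top
      obtain ⟨E, i1, i2, hE, hc⟩ := exists_isArtinian_cogenerator 𝔪
      exact ⟨E, i1, i2, hE, fun _ => ⟨𝔪, hle, hc⟩⟩
    · exact ⟨PUnit, inferInstance, inferInstance, inferInstance, fun h => (hp h).elim⟩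
  choose E i1 i2 hart hE using hcog
  have hp : ∃ p ∈ associatedPrimes R H, ∀ k, ∃ (φ : H →ₗ[R] E p) (h : H), φ (x ^ k • h) ≠ 0 := by
    by_contra! hcon
    choose! k hk using hcon
    -- Finiteness of Ass H gives one exponent K for all p. An associated prime of R x ^ K h ≠ 0 then
    -- yields a map to some `E p` not killed by x ^ K.
    obtain ⟨K, hK⟩ := (hass.image k).bddAbove
    push Not at hx
    obtain ⟨h, hh⟩ := hx K
    let W : Submodule R H := Submodule.span R {x ^ K • h}
    have : Nontrivial W := ⟨⟨⟨x ^ K • h, Submodule.mem_span_singleton_self _⟩, 0, fun e =>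
      hh (congrArg Subtype.val e)⟩⟩
    obtain ⟨p, hpW⟩ := associatedPrimes.nonempty R W
    have hpH := associatedPrimes.subset_of_injective (f := W.subtype) W.injective_subtype hpW
    obtain ⟨hpp, w, hw⟩ := isAssociatedPrime_iff.1 hpW
    obtain ⟨r, hr⟩ := Submodule.mem_span_singleton.1 w.2
    obtain ⟨𝔪, hle, hc⟩ := hE p hpp
    obtain ⟨φ, hφ⟩ := hc H w (fun a ha => hle (by
      rw [hw, Submodule.mem_colon_singleton, Submodule.mem_bot]
      exact Subtype.ext ha))
    apply hφ
    have hkK : k p ≤ K := hK ⟨p, hpH, rfl⟩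
    rw [← hr, ← Nat.sub_add_cancel hkK, pow_add, mul_smul, smul_smul, map_smul, hk p hpH, smul_zero]
  obtain ⟨p, -, hφ⟩ := hp
  obtain ⟨φ, hφ⟩ := exists_hom_forall_pow_smul_ne_zero x htors hφ
  -- The images of x ^ k • φ decrease, so they stabilize; x is surjective on the stable image.
  obtain ⟨n, hn⟩ := IsArtinian.monotone_stabilizes (R := R) (M := E p)
    ⟨fun k => OrderDual.toDual (LinearMap.range (x ^ k • φ)), by
      refine monotone_nat_of_le_succ fun k => ?_
      change LinearMap.range (x ^ (k + 1) • φ) ≤ LinearMap.range (x ^ k • φ)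
      rintro _ ⟨h, rfl⟩
      exact ⟨x • h, by simp only [LinearMap.smul_apply, map_smul, smul_smul, pow_succ, mul_comm]⟩⟩
  have hn' : LinearMap.range (x ^ n • φ) = LinearMap.range (x ^ (n + 1) • φ) :=
    hn (n + 1) (Nat.le_succ n)
  refine ⟨LinearMap.ker (x ^ n • φ), ?_, ?_, ?_⟩
  · intro htop
    obtain ⟨h, hh⟩ := hφ n
    apply hh
    rw [map_smul]
    exact LinearMap.mem_ker.1 (htop.ge (trivial : h ∈ (⊤ : Submodule R H)))
  · have := hart p
    exact isArtinian_of_injective _ (LinearMap.ker_eq_bot.1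
      (Submodule.ker_liftQ_eq_bot' (LinearMap.ker (x ^ n • φ)) (x ^ n • φ) rfl))
  · intro q
    obtain ⟨h, rfl⟩ := Submodule.mkQ_surjective _ q
    have : (x ^ n • φ) h ∈ LinearMap.range (x ^ (n + 1) • φ) := hn' ▸ ⟨h, rfl⟩
    obtain ⟨h', hh'⟩ := this
    refine ⟨Submodule.mkQ _ h', ?_⟩
    rw [← map_smul, Submodule.mkQ_apply, Submodule.mkQ_apply, Submodule.Quotient.eq,
      LinearMap.mem_ker, map_sub, sub_eq_zero, ← hh']
    simp only [LinearMap.smul_apply, map_smul, smul_smul, pow_succ, mul_comm]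

/-- On a simple quotient, a surjective x is injective, which contradicts x-torsion. -/
lemma exists_pow_smul_eq_zero_of_isCoatomicModule (x : R) (htors : ∀ h : H, ∃ t, x ^ t • h = 0)
    (hass : (associatedPrimes R H).Finite) (hH : IsCoatomicModule R H) :
    ∃ k, ∀ h : H, x ^ k • h = 0 := by
  by_contra hx
  obtain ⟨U, hU, -, hsurj⟩ := exists_artinian_quotient_smul_surjective x htors hass hx
  obtain ⟨V, hV, hUV⟩ := hH U hU
  have hdiv : ∀ h : H, ∃ h', h - x • h' ∈ V := fun h => by
    obtain ⟨q, hq⟩ := hsurj (U.mkQ h)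
    obtain ⟨h', rfl⟩ := U.mkQ_surjective q
    refine ⟨h', hUV ?_⟩
    rwa [← map_smul, Submodule.mkQ_apply, Submodule.mkQ_apply, Submodule.Quotient.eq] at hq
  let V' : Submodule R H := V.comap (x • LinearMap.id)
  have hV' : V' = V := by
    refine (hV.le_iff.1 (fun v hv => V.smul_mem x hv : V ≤ V')).resolve_left fun htop => ?_
    refine hV.1 (eq_top_iff.2 fun h _ => ?_)
    obtain ⟨h', hh'⟩ := hdiv h
    have : x • h' ∈ V := (htop ▸ trivial : h' ∈ V')
    simpa using V.add_mem hh' this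
  refine hV.1 (eq_top_iff.2 fun h _ => ?_)
  obtain ⟨t, ht⟩ := htors h
  have hpow : ∀ t, ∀ h : H, x ^ t • h ∈ V → h ∈ V := by
    intro t
    induction t with
    | zero => intro h hh; simpa using hh
    | succ t ih =>
      intro h hh
      refine ih h ?_
      rw [← hV']
      change x • x ^ t • h ∈ V
      rwa [smul_smul, ← pow_succ']
  exact hpow t h (ht ▸ V.zero_mem)

/-- Take V ≥ U proper with Ann(H/V) maximal. If ab kills H/V and b does not, then (V : b) is proper,
so by maximality its quotient has the same annihilator, which contains a. Hence Ann(H/V) is prime.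
-/
lemma exists_mem_coass_of_isArtinian_quotient (U : Submodule R H) (hU : U ≠ ⊤)
    (hart : IsArtinian R (H ⧸ U)) :
    ∃ V : Submodule R H, U ≤ V ∧ V ≠ ⊤ ∧
      ∃ p ∈ coass R H, ∀ r ∈ p.asIdeal, ∀ h : H, r • h ∈ V := by
  obtain ⟨J, ⟨V, ⟨hUV, hV⟩, rfl⟩, hmax⟩ := set_has_maximal_iff_noetherian.mpr
    ‹IsNoetherianRing R› ((fun V : Submodule R H => Module.annihilator R (H ⧸ V)) ''
      {V | U ≤ V ∧ V ≠ ⊤}) ⟨_, U, ⟨le_rfl, hU⟩, rfl⟩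
  have hmem : ∀ (W : Submodule R H) (r : R),
      r ∈ Module.annihilator R (H ⧸ W) ↔ ∀ h : H, r • h ∈ W := fun W r => by
    rw [Module.mem_annihilator, W.mkQ_surjective.forall]
    refine forall_congr' fun h => ?_
    rw [← map_smul, Submodule.mkQ_apply, Submodule.Quotient.mk_eq_zero]
  have hprime : (Module.annihilator R (H ⧸ V)).IsPrime := by
    refine ⟨fun h => hV ?_, fun {a b} hab => or_iff_not_imp_right.2 fun hb => ?_⟩
    · refine eq_top_iff.2 fun y _ => ?_
      simpa using (hmem V 1).1 (h ▸ trivial) y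
    · let W : Submodule R H := V.comap (b • LinearMap.id)
      have hVW : V ≤ W := fun v hv => V.smul_mem b hv
      have hW : W ≠ ⊤ := fun h => hb ((hmem V b).2 fun y => (h ▸ trivial : y ∈ W))
      have hle : Module.annihilator R (H ⧸ V) ≤ Module.annihilator R (H ⧸ W) := fun r hr =>
        (hmem W r).2 fun h => hVW ((hmem V r).1 hr h)
      have heq := hle.eq_of_not_lt (hmax _ ⟨W, ⟨hUV.trans hVW, hW⟩, rfl⟩)
      rw [heq, hmem]
      intro h
      change b • a • h ∈ V
      rw [smul_smul, mul_comm]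
      exact (hmem V _).1 hab h
  refine ⟨V, hUV, hV, ⟨_, hprime⟩, ⟨V, ?_, rfl⟩, fun r hr => (hmem V r).1 hr⟩
  exact isArtinian_of_surjective _ (Submodule.factor hUV) (Submodule.factor_surjective hUV)

lemma exists_pow_smul_eq_zero_of_coass (x : R) (htors : ∀ h : H, ∃ t, x ^ t • h = 0)
    (hass : (associatedPrimes R H).Finite) (hH : ∀ p ∈ coass R H, x ∈ p.asIdeal) :
    ∃ k, ∀ h : H, x ^ k • h = 0 := by
  by_contra hx
  obtain ⟨U, hU, hart, hsurj⟩ := exists_artinian_quotient_smul_surjective x htors hass hx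
  obtain ⟨V, hUV, hV, p, hp, hpV⟩ := exists_mem_coass_of_isArtinian_quotient U hU hart
  refine hV (eq_top_iff.2 fun h _ => ?_)
  obtain ⟨q, hq⟩ := hsurj (U.mkQ h)
  obtain ⟨h', rfl⟩ := U.mkQ_surjective q
  rw [← map_smul, Submodule.mkQ_apply, Submodule.mkQ_apply, Submodule.Quotient.eq] at hq
  simpa using V.add_mem (hUV hq) (hpV x (hH p hp) h')

end Torsion

/-! ### Finiteness of a torsion module from its 𝔞-socle -/

section IdealColon

variable {R : Type u} [CommRing R] {H : Type u} [AddCommGroup H] [Module R H]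

/-- The elements `h` such that `𝔞 • h` lies in `A`. -/
def idealColon (𝔞 : Ideal R) (A : Submodule R H) : Submodule R H where
  carrier := {h | ∀ a ∈ 𝔞, a • h ∈ A}
  add_mem' := fun h1 h2 a ha => by rw [smul_add]; exact A.add_mem (h1 a ha) (h2 a ha)
  zero_mem' := fun a _ => by rw [smul_zero]; exact A.zero_mem
  smul_mem' := fun r h h1 a ha => by rw [smul_comm]; exact A.smul_mem r (h1 a ha)

lemma isCoatomicModule_of_finite [Module.Finite R H] : IsCoatomicModule R H := fun U hU =>
  (eq_top_or_exists_le_coatom U).resolve_left hU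

lemma coass_subset_of_finite {𝔞 : Ideal R} [Module.Finite R H]
    (htors : ∀ h : H, ∃ t, ∀ a ∈ 𝔞 ^ t, a • h = 0) :
    coass R H ⊆ PrimeSpectrum.zeroLocus (𝔞 : Set R) := by
  rintro p ⟨U, -, hU⟩
  obtain ⟨s, hs⟩ := Module.Finite.fg_top (R := R) (M := H)
  choose t ht using htors
  have hle : 𝔞 ^ (s.sup t) ≤ p.asIdeal := fun a ha => by
    rw [← hU, Module.mem_annihilator]
    intro q
    obtain ⟨h, rfl⟩ := U.mkQ_surjective q
    rw [← map_smul]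
    have : a • h = 0 := by
      have hh : h ∈ Submodule.span R (s : Set H) := hs ▸ trivial
      induction hh using Submodule.span_induction with
      | mem h hh => exact ht h a (Ideal.pow_le_pow_right (Finset.le_sup hh) ha)
      | zero => exact smul_zero a
      | add y z _ _ hy hz => rw [smul_add, hy, hz, add_zero]
      | smul r y _ hy => rw [smul_comm, hy, smul_zero]
    rw [this, map_zero]
  exact fun a ha => p.isPrime.le_of_pow_le hle ha

variable [IsNoetherianRing R] {𝔞 : Ideal R}

/-- Multiplication by generators of 𝔞 maps (A : 𝔞) into a finite power of A, with kernel inside (0 :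
𝔞). -/
lemma fg_idealColon {A : Submodule R H} (hA : A.FG) (hbot : (idealColon 𝔞 (⊥ : Submodule R H)).FG) :
    (idealColon 𝔞 A).FG := by
  obtain ⟨n, a, ha⟩ := Submodule.fg_iff_exists_fin_generating_family.1
    (IsNoetherian.noetherian 𝔞)
  have ham : ∀ i, a i ∈ 𝔞 := fun i => by
    rw [← ha]; exact Submodule.subset_span ⟨i, rfl⟩
  let f : H →ₗ[R] (Fin n → H) := LinearMap.pi fun i => a i • LinearMap.id
  refine Submodule.fg_of_fg_map_of_fg_inf_ker f ?_ ?_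
  · have : Module.Finite R A := Module.Finite.iff_fg.2 hA
    let g : (Fin n → A) →ₗ[R] (Fin n → H) := LinearMap.pi fun i => A.subtype ∘ₗ LinearMap.proj i
    have hle : (idealColon 𝔞 A).map f ≤ LinearMap.range g := by
      rintro _ ⟨h, hh, rfl⟩
      exact ⟨fun i => ⟨a i • h, hh _ (ham i)⟩, rfl⟩
    exact Submodule.FG.of_le (Module.Finite.iff_fg.1 inferInstance) hle
  · refine Submodule.FG.of_le hbot fun h hh b hb => ?_
    rw [Submodule.mem_bot]
    rw [← ha] at hb
    induction hb using Submodule.span_induction with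
    | mem b hb =>
      obtain ⟨i, rfl⟩ := hb
      exact congrFun (LinearMap.mem_ker.1 hh.2) i
    | zero => simp
    | add b c _ _ hb hc => rw [add_smul, hb, hc, add_zero]
    | smul r b _ hb => rw [smul_eq_mul, mul_smul, hb, smul_zero]

lemma fg_idealColon_pow_bot (hbot : (idealColon 𝔞 (⊥ : Submodule R H)).FG) (c : ℕ) :
    (idealColon (𝔞 ^ c) (⊥ : Submodule R H)).FG := by
  induction c with
  | zero =>
    refine Submodule.FG.of_le Submodule.fg_bot fun h hh => ?_
    simpa using hh 1 (by simp)
  | succ c ih =>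
    refine Submodule.FG.of_le (fg_idealColon ih hbot) fun h hh a ha b hb => ?_
    rw [smul_smul]
    exact hh _ (by rw [pow_succ]; exact Ideal.mul_mem_mul hb ha)

lemma finite_of_forall_exists_pow_smul_eq_zero (hbot : (idealColon 𝔞 (⊥ : Submodule R H)).FG)
    (hx : ∀ x ∈ 𝔞, ∃ k, ∀ h : H, x ^ k • h = 0) : Module.Finite R H := by
  obtain ⟨c, hc⟩ := Ideal.exists_pow_le_of_le_radical_of_fg
    (I := 𝔞) (J := Module.annihilator R H) (fun x hxa => by
      obtain ⟨k, hk⟩ := hx x hxa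
      exact ⟨k, Module.mem_annihilator.2 hk⟩) (IsNoetherian.noetherian 𝔞)
  refine ⟨Submodule.FG.of_le (fg_idealColon_pow_bot hbot c) fun h _ a ha => ?_⟩
  exact Module.mem_annihilator.1 (hc ha) h

/-- Torsion forces 𝔞 ≤ p for each associated prime p, so an element with annihilator p already lies
in (0 : 𝔞). -/
lemma finite_associatedPrimes_of_fg_idealColon (htors : ∀ h : H, ∃ t, ∀ a ∈ 𝔞 ^ t, a • h = 0)
    (hbot : (idealColon 𝔞 (⊥ : Submodule R H)).FG) : (associatedPrimes R H).Finite := by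
  have : Module.Finite R (idealColon 𝔞 (⊥ : Submodule R H)) := Module.Finite.iff_fg.2 hbot
  refine (associatedPrimes.finite R (idealColon 𝔞 (⊥ : Submodule R H))).subset fun p hp => ?_
  obtain ⟨hpp, h, hh⟩ := isAssociatedPrime_iff.1 hp
  obtain ⟨t, ht⟩ := htors h
  have hap : 𝔞 ≤ p := hpp.le_of_pow_le (n := t) fun a ha => by
    rw [hh, Submodule.mem_colon_singleton, Submodule.mem_bot]
    exact ht a ha
  have hmem : h ∈ idealColon 𝔞 (⊥ : Submodule R H) := fun a ha => by
    rw [← Submodule.mem_colon_singleton, ← hh]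
    exact hap ha
  refine isAssociatedPrime_iff.2 ⟨hpp, ⟨h, hmem⟩, ?_⟩
  ext r
  rw [hh, Submodule.mem_colon_singleton, Submodule.mem_colon_singleton, Submodule.mem_bot,
    Submodule.mem_bot, Subtype.ext_iff]
  rfl

lemma finite_of_isCoatomicModule (htors : ∀ h : H, ∃ t, ∀ a ∈ 𝔞 ^ t, a • h = 0)
    (hbot : (idealColon 𝔞 (⊥ : Submodule R H)).FG) (hH : IsCoatomicModule R H) :
    Module.Finite R H :=
  finite_of_forall_exists_pow_smul_eq_zero hbot fun x hx =>
    exists_pow_smul_eq_zero_of_isCoatomicModule x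
      (fun h => (htors h).imp fun t ht => ht _ (Ideal.pow_mem_pow hx t))
      (finite_associatedPrimes_of_fg_idealColon htors hbot) hH

lemma finite_of_coass_subset (htors : ∀ h : H, ∃ t, ∀ a ∈ 𝔞 ^ t, a • h = 0)
    (hbot : (idealColon 𝔞 (⊥ : Submodule R H)).FG)
    (hH : coass R H ⊆ PrimeSpectrum.zeroLocus (𝔞 : Set R)) : Module.Finite R H :=
  finite_of_forall_exists_pow_smul_eq_zero hbot fun x hx =>
    exists_pow_smul_eq_zero_of_coass x
      (fun h => (htors h).imp fun t ht => ht _ (Ideal.pow_mem_pow hx t))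
      (finite_associatedPrimes_of_fg_idealColon htors hbot) fun _ hp => hH hp hx

end IdealColon

/-! ### Contravariant Ext: functoriality and connecting maps -/

section ExtMap

variable {R : Type u} [CommRing R] (N : Type u) [AddCommGroup N] [Module R N]

/-- The map `Ext^i(Y, N) → Ext^i(X, N)` induced by a linear map `X → Y`. -/
def extMap {X Y : Type u} [AddCommGroup X] [Module R X] [AddCommGroup Y] [Module R Y]
    (g : X →ₗ[R] Y) (i : ℕ) :
    Abelian.Ext (ModuleCat.of R Y) (ModuleCat.of R N) i →ₗ[R]
      Abelian.Ext (ModuleCat.of R X) (ModuleCat.of R N) i :=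
  (Abelian.Ext.mk₀ (ModuleCat.ofHom g)).precompOfLinear R (ModuleCat.of R N) (zero_add i)

variable {X Y Z : Type u} [AddCommGroup X] [Module R X] [AddCommGroup Y] [Module R Y]
  [AddCommGroup Z] [Module R Z]

lemma extMap_apply (g : X →ₗ[R] Y) (i : ℕ)
    (e : Abelian.Ext (ModuleCat.of R Y) (ModuleCat.of R N) i) :
    extMap N g i e = (Abelian.Ext.mk₀ (ModuleCat.ofHom g)).comp e (zero_add i) := rfl

lemma extMap_extMap (f : X →ₗ[R] Y) (g : Y →ₗ[R] Z) (i : ℕ)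
    (e : Abelian.Ext (ModuleCat.of R Z) (ModuleCat.of R N) i) :
    extMap N f i (extMap N g i e) = extMap N (g ∘ₗ f) i e := by
  simp only [extMap_apply, ModuleCat.ofHom_comp, ← Abelian.Ext.mk₀_comp_mk₀,
    Abelian.Ext.mk₀_comp_mk₀_assoc]

lemma extMap_comp (f : X →ₗ[R] Y) (g : Y →ₗ[R] Z) (i : ℕ) :
    extMap N (g ∘ₗ f) i = extMap N f i ∘ₗ extMap N g i :=
  LinearMap.ext fun e => (extMap_extMap N f g i e).symm

lemma extMap_smul_id (r : R) (i : ℕ)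
    (e : Abelian.Ext (ModuleCat.of R X) (ModuleCat.of R N) i) :
    extMap N (r • LinearMap.id : X →ₗ[R] X) i e = r • e := by
  have : ModuleCat.ofHom (r • LinearMap.id : X →ₗ[R] X) = r • 𝟙 (ModuleCat.of R X) := by
    ext; rfl
  rw [extMap_apply, this, Abelian.Ext.mk₀_smul, Abelian.Ext.smul_comp,
    Abelian.Ext.mk₀_id_comp]

lemma extMap_zero (i : ℕ) (e : Abelian.Ext (ModuleCat.of R Y) (ModuleCat.of R N) i) :
    extMap N (0 : X →ₗ[R] Y) i e = 0 := by
  have : ModuleCat.ofHom (0 : X →ₗ[R] Y) = 0 := rfl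
  rw [extMap_apply, this, Abelian.Ext.mk₀_zero, Abelian.Ext.zero_comp]

variable {N} {f : X →ₗ[R] Y} {g : Y →ₗ[R] Z}

lemma shortExact_mk (hf : Function.Injective f) (hg : Function.Surjective g)
    (hfg : Function.Exact f g) :
    (ShortComplex.mk (ModuleCat.ofHom f) (ModuleCat.ofHom g)
      (by ext x; exact hfg.apply_apply_eq_zero x)).ShortExact where
  exact := (ShortComplex.ShortExact.moduleCat_exact_iff_function_exact _).mpr hfg
  mono_f := (ModuleCat.mono_iff_injective _).mpr hf
  epi_g := (ModuleCat.epi_iff_surjective _).mpr hg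

lemma exists_extMap_eq (hf : Function.Injective f) (hg : Function.Surjective g)
    (hfg : Function.Exact f g) {i : ℕ}
    (e : Abelian.Ext (ModuleCat.of R Y) (ModuleCat.of R N) i) (he : extMap N f i e = 0) :
    ∃ e', extMap N g i e' = e :=
  Abelian.Ext.contravariant_sequence_exact₂ (shortExact_mk hf hg hfg) _ e he

lemma extMap_zero_injective (hg : Function.Surjective g) :
    Function.Injective (extMap N g 0) :=
  have : Epi (ModuleCat.ofHom g) := (ModuleCat.epi_iff_surjective _).mpr hg
  Abelian.Ext.precomp_mk₀_injective_of_epi (ModuleCat.of R N) (ModuleCat.ofHom g)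

variable (N) in
/-- The connecting map `Ext^i(X, N) → Ext^(i+1)(Z, N)` of a short exact sequence. -/
def extConnecting (hf : Function.Injective f) (hg : Function.Surjective g)
    (hfg : Function.Exact f g) (i : ℕ) :
    Abelian.Ext (ModuleCat.of R X) (ModuleCat.of R N) i →ₗ[R]
      Abelian.Ext (ModuleCat.of R Z) (ModuleCat.of R N) (i + 1) :=
  (shortExact_mk hf hg hfg).extClass.precompOfLinear R (ModuleCat.of R N) (add_comm 1 i)

lemma exists_extConnecting_eq (hf : Function.Injective f) (hg : Function.Surjective g)
    (hfg : Function.Exact f g) {i : ℕ}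
    (e : Abelian.Ext (ModuleCat.of R Z) (ModuleCat.of R N) (i + 1))
    (he : extMap N g (i + 1) e = 0) :
    ∃ b, extConnecting N hf hg hfg i b = e :=
  Abelian.Ext.contravariant_sequence_exact₃ (shortExact_mk hf hg hfg) _ e he (add_comm 1 i)

lemma extConnecting_extMap {X' Y' Z' : Type u} [AddCommGroup X'] [Module R X'] [AddCommGroup Y']
    [Module R Y'] [AddCommGroup Z'] [Module R Z'] {f' : X' →ₗ[R] Y'} {g' : Y' →ₗ[R] Z'}
    (hf : Function.Injective f) (hg : Function.Surjective g) (hfg : Function.Exact f g)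
    (hf' : Function.Injective f') (hg' : Function.Surjective g') (hfg' : Function.Exact f' g')
    (u : X →ₗ[R] X') (v : Y →ₗ[R] Y') (w : Z →ₗ[R] Z') (huv : f' ∘ₗ u = v ∘ₗ f)
    (hvw : g' ∘ₗ v = w ∘ₗ g) (i : ℕ)
    (b : Abelian.Ext (ModuleCat.of R X') (ModuleCat.of R N) i) :
    extConnecting N hf hg hfg i (extMap N u i b) =
      extMap N w (i + 1) (extConnecting N hf' hg' hfg' i b) := by
  have := ShortComplex.ShortExact.extClass_naturality (shortExact_mk hf hg hfg)
    (shortExact_mk hf' hg' hfg')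
    { τ₁ := ModuleCat.ofHom u
      τ₂ := ModuleCat.ofHom v
      τ₃ := ModuleCat.ofHom w
      comm₁₂ := by ext x; exact LinearMap.congr_fun huv x
      comm₂₃ := by ext x; exact LinearMap.congr_fun hvw x }
  change (shortExact_mk hf hg hfg).extClass.comp
      ((Abelian.Ext.mk₀ (ModuleCat.ofHom u)).comp b (zero_add i)) (add_comm 1 i) =
    (Abelian.Ext.mk₀ (ModuleCat.ofHom w)).comp
      ((shortExact_mk hf' hg' hfg').extClass.comp b (add_comm 1 i)) (zero_add (i + 1))
  rw [← Abelian.Ext.comp_assoc _ _ _ (add_zero 1) (zero_add i) (by omega),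
    ← Abelian.Ext.comp_assoc _ _ _ (zero_add 1) (add_comm 1 i) (by omega)]
  exact congrArg (fun c => Abelian.Ext.comp c b (add_comm 1 i)) this

end ExtMap

/-! ### Functoriality of generalized local cohomology in the first variable -/

section Functoriality

variable {R : Type u} [CommRing R] (𝔞 : Ideal R) (N : Type u) [AddCommGroup N] [Module R N]
  {K M L : Type u} [AddCommGroup K] [Module R K] [AddCommGroup M] [Module R M]
  [AddCommGroup L] [Module R L]

lemma smul_top_le_comap (I : Ideal R) (f : K →ₗ[R] M) :
    (I • ⊤ : Submodule R K) ≤ (I • ⊤ : Submodule R M).comap f := by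
  rw [← Submodule.map_le_iff_le_comap, Submodule.map_smul'']
  exact Submodule.smul_mono le_rfl le_top

/-- The map `K / 𝔞 ^ t K → M / 𝔞 ^ t M` induced by `K → M`. -/
def quotPow (f : K →ₗ[R] M) (t : ℕ) :
    (K ⧸ (𝔞 ^ t • ⊤ : Submodule R K)) →ₗ[R] (M ⧸ (𝔞 ^ t • ⊤ : Submodule R M)) :=
  Submodule.mapQ _ _ f (smul_top_le_comap _ f)

lemma extQuotPowMap_eq (i s t : ℕ) (h : s ≤ t) :
    extQuotPowMap 𝔞 M N i s t h = extMap N (quotPowMap 𝔞 M h) i := rfl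

lemma quotPow_comp_quotPowMap (f : K →ₗ[R] M) {s t : ℕ} (h : s ≤ t) :
    quotPow 𝔞 f s ∘ₗ quotPowMap 𝔞 K h = quotPowMap 𝔞 M h ∘ₗ quotPow 𝔞 f t := by
  ext; rfl

/-- The map `H^i_𝔞(M, N) → H^i_𝔞(K, N)` induced by `K → M`. -/
def genMap (f : K →ₗ[R] M) (i : ℕ) :
    genLocalCohomology 𝔞 i M N →ₗ[R] genLocalCohomology 𝔞 i K N :=
  Module.DirectLimit.map (fun t => extMap N (quotPow 𝔞 f t) i) fun s t h => by
    rw [extQuotPowMap_eq, extQuotPowMap_eq, ← extMap_comp, ← extMap_comp, quotPow_comp_quotPowMap]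

/-- The map from the `t`-th stage to the colimit. -/
abbrev toGen (M : Type u) [AddCommGroup M] [Module R M] (i t : ℕ) :
    extQuotPow 𝔞 M N i t →ₗ[R] genLocalCohomology 𝔞 i M N :=
  Module.DirectLimit.of R ℕ (extQuotPow 𝔞 M N i) (extQuotPowMap 𝔞 M N i) t

variable {N}

lemma genMap_toGen (f : K →ₗ[R] M) (i t : ℕ) (e : extQuotPow 𝔞 M N i t) :
    genMap 𝔞 N f i (toGen 𝔞 N M i t e) = toGen 𝔞 N K i t (extMap N (quotPow 𝔞 f t) i e) :=
  Module.DirectLimit.map_apply_of _ _ _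

lemma exists_toGen {i : ℕ} (z : genLocalCohomology 𝔞 i M N) : ∃ t e, toGen 𝔞 N M i t e = z :=
  Module.DirectLimit.exists_of z

lemma toGen_extQuotPowMap {i s t : ℕ} (h : s ≤ t) (e : extQuotPow 𝔞 M N i s) :
    toGen 𝔞 N M i t (extQuotPowMap 𝔞 M N i s t h e) = toGen 𝔞 N M i s e :=
  Module.DirectLimit.of_f

lemma toGen_eq_zero {i t : ℕ} {e : extQuotPow 𝔞 M N i t} (h : toGen 𝔞 N M i t e = 0) :
    ∃ s, ∃ hs : t ≤ s, extQuotPowMap 𝔞 M N i t s hs e = 0 :=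
  Module.DirectLimit.of.zero_exact h

lemma genMap_smul_id (r : R) (i : ℕ) (z : genLocalCohomology 𝔞 i M N) :
    genMap 𝔞 N (r • LinearMap.id : M →ₗ[R] M) i z = r • z := by
  obtain ⟨t, e, rfl⟩ := exists_toGen 𝔞 z
  have : quotPow 𝔞 (r • LinearMap.id : M →ₗ[R] M) t = r • LinearMap.id := by
    ext; rfl
  rw [genMap_toGen, this, extMap_smul_id, map_smul]

lemma genLocalCohomology_torsion {i : ℕ} (z : genLocalCohomology 𝔞 i M N) :
    ∃ t, ∀ a ∈ 𝔞 ^ t, a • z = 0 := by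
  obtain ⟨t, e, rfl⟩ := exists_toGen 𝔞 z
  refine ⟨t, fun a ha => ?_⟩
  have : (a • LinearMap.id : (M ⧸ (𝔞 ^ t • ⊤ : Submodule R M)) →ₗ[R] _) = 0 := by
    ext m
    exact (Submodule.Quotient.mk_eq_zero _).2 (Submodule.smul_mem_smul ha trivial)
  rw [← map_smul, ← extMap_smul_id, this, extMap_zero, map_zero]

/-- If `𝔞 K = 0`, the colimit is reached at the first stage. -/
lemma finite_genLocalCohomology_of_smul_eq_zero [IsNoetherianRing R] [Module.Finite R N]
    [Module.Finite R K] (hK : ∀ a ∈ 𝔞, ∀ k : K, a • k = 0) (i : ℕ) :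
    Module.Finite R (genLocalCohomology 𝔞 i K N) := by
  refine Module.Finite.of_surjective (toGen 𝔞 N K i 1) fun z => ?_
  have hbot : ∀ t, (𝔞 ^ (t + 1) • ⊤ : Submodule R K) = ⊥ := fun t => by
    rw [eq_bot_iff, Submodule.smul_le]
    intro a ha k _
    exact hK a (Ideal.pow_le_self (Nat.succ_ne_zero t) ha) k
  obtain ⟨t, e, rfl⟩ := exists_toGen 𝔞 z
  -- Stage 0 is Ext of the zero module; from stage 1 on, the quotient is K itself.
  rw [← toGen_extQuotPowMap 𝔞 (Nat.le_succ t) e]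
  generalize extQuotPowMap 𝔞 K N i t t.succ _ e = e'
  have h1 : 1 ≤ t.succ := Nat.succ_le_succ (Nat.zero_le t)
  let g : (K ⧸ (𝔞 ^ 1 • ⊤ : Submodule R K)) →ₗ[R] (K ⧸ (𝔞 ^ t.succ • ⊤ : Submodule R K)) :=
    Submodule.factor (by rw [hbot t]; exact (hbot 0).le)
  refine ⟨extMap N g i e', ?_⟩
  rw [← toGen_extQuotPowMap 𝔞 h1, extQuotPowMap_eq, extMap_extMap]
  have : g ∘ₗ quotPowMap 𝔞 K h1 = (1 : R) • LinearMap.id := by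
    rw [one_smul]
    ext; rfl
  rw [this, extMap_smul_id, one_smul]

/-- Artin–Rees. It lets K/(K ∩ 𝔞 ^ t M), which fits into short exact sequences, be compared with K/𝔞
^ t K. -/
lemma exists_comap_pow_smul_top_le [IsNoetherianRing R] [Module.Finite R M] {f : K →ₗ[R] M}
    (hf : Function.Injective f) (s : ℕ) :
    ∃ t, s ≤ t ∧ (𝔞 ^ t • ⊤ : Submodule R M).comap f ≤ (𝔞 ^ s • ⊤ : Submodule R K) := by
  obtain ⟨k, hk⟩ := Ideal.exists_pow_inf_eq_pow_smul 𝔞 (LinearMap.range f)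
  refine ⟨k + s, Nat.le_add_left s k, fun x hx => ?_⟩
  have hmem : f x ∈ (𝔞 ^ (k + s) • ⊤ ⊓ LinearMap.range f : Submodule R M) := ⟨hx, x, rfl⟩
  rw [hk _ (Nat.le_add_right k s), Nat.add_sub_cancel_left] at hmem
  have : f x ∈ (𝔞 ^ s • ⊤ : Submodule R K).map f := by
    rw [Submodule.map_smul'', Submodule.map_top]
    exact Submodule.smul_mono (le_refl (𝔞 ^ s)) inf_le_right hmem
  obtain ⟨y, hy, hyx⟩ := this
  rwa [← hf hyx]

end Functoriality

/-! ### Pieces of the long exact sequence -/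

section LongExactSequence

variable {R : Type u} [CommRing R] {𝔞 : Ideal R} {N : Type u} [AddCommGroup N] [Module R N]
  {K M L : Type u} [AddCommGroup K] [Module R K] [AddCommGroup M] [Module R M]
  [AddCommGroup L] [Module R L] {f : K →ₗ[R] M} {g : M →ₗ[R] L}

variable (𝔞 f) in
/-- The filtration of `K` induced by the `𝔞`-adic filtration of `M` along `f : K → M`. -/
abbrev indFil (t : ℕ) : Submodule R K := (𝔞 ^ t • ⊤ : Submodule R M).comap f

variable (𝔞 f) in
/-- The map `K / (K ∩ 𝔞 ^ t M) → M / 𝔞 ^ t M`. -/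
def indQuot (t : ℕ) : (K ⧸ indFil 𝔞 f t) →ₗ[R] (M ⧸ (𝔞 ^ t • ⊤ : Submodule R M)) :=
  Submodule.mapQ _ _ f le_rfl

lemma indQuot_injective (t : ℕ) : Function.Injective (indQuot 𝔞 f t) := by
  rw [← LinearMap.ker_eq_bot, indQuot, Submodule.ker_mapQ, Submodule.mkQ_map_self]

lemma quotPow_surjective (hg : Function.Surjective g) (t : ℕ) :
    Function.Surjective (quotPow 𝔞 g t) := by
  intro y
  obtain ⟨y, rfl⟩ := Submodule.mkQ_surjective _ y
  obtain ⟨x, rfl⟩ := hg y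
  exact ⟨Submodule.mkQ _ x, rfl⟩

lemma indQuot_exact_quotPow (hg : Function.Surjective g) (hfg : Function.Exact f g) (t : ℕ) :
    Function.Exact (indQuot 𝔞 f t) (quotPow 𝔞 g t) := by
  intro y
  obtain ⟨y, rfl⟩ := Submodule.mkQ_surjective _ y
  constructor
  · intro hy
    have hy' : g y ∈ (𝔞 ^ t • ⊤ : Submodule R L) := (Submodule.Quotient.mk_eq_zero _).1 hy
    rw [← LinearMap.range_eq_top.2 hg, ← Submodule.map_top, ← Submodule.map_smul''] at hy'
    obtain ⟨z, hz, hzy⟩ := hy'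
    obtain ⟨x, hx⟩ := (hfg (y - z)).1 (by rw [map_sub, hzy, sub_self])
    refine ⟨Submodule.mkQ _ x, ?_⟩
    change Submodule.Quotient.mk (f x) = Submodule.Quotient.mk y
    rw [Submodule.Quotient.eq, hx]
    simpa using Submodule.neg_mem _ hz
  · rintro ⟨x, hx⟩
    obtain ⟨x, rfl⟩ := Submodule.mkQ_surjective _ x
    rw [← hx]
    change Submodule.Quotient.mk (g (f x)) = 0
    rw [hfg.apply_apply_eq_zero, Submodule.Quotient.mk_zero]

/-- The map `K / (K ∩ 𝔞 ^ t M) → K / (K ∩ 𝔞 ^ s M)` for `s ≤ t`. -/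
def indQuotMap {s t : ℕ} (h : s ≤ t) : (K ⧸ indFil 𝔞 f t) →ₗ[R] (K ⧸ indFil 𝔞 f s) :=
  Submodule.factor (Submodule.comap_mono (Submodule.smul_mono_left (Ideal.pow_le_pow_right h)))

variable (𝔞 f) in
/-- The map `K / 𝔞 ^ t K → K / (K ∩ 𝔞 ^ t M)`. -/
def adicToInd (t : ℕ) : (K ⧸ (𝔞 ^ t • ⊤ : Submodule R K)) →ₗ[R] (K ⧸ indFil 𝔞 f t) :=
  Submodule.factor (smul_top_le_comap _ f)

/-- Presents a cokernel over M/U as a quotient of M by a larger submodule, the form needed for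
noetherian induction. -/
lemma exact_factor_comap_mkQ {U : Submodule R M}
    (f : K →ₗ[R] M ⧸ U) :
    Function.Exact f (Submodule.factor (U.le_comap_mkQ (LinearMap.range f))) := by
  intro y
  obtain ⟨y, rfl⟩ := U.mkQ_surjective y
  change Submodule.Quotient.mk y = 0 ↔ _
  rw [Submodule.Quotient.mk_eq_zero]
  rfl

variable [IsNoetherianRing R] [Module.Finite R M]

lemma exists_genMap_eq (hf : Function.Injective f) (hg : Function.Surjective g)
    (hfg : Function.Exact f g) {i : ℕ} (z : genLocalCohomology 𝔞 i M N)
    (hz : genMap 𝔞 N f i z = 0) : ∃ y, genMap 𝔞 N g i y = z := by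
  obtain ⟨t, e, rfl⟩ := exists_toGen 𝔞 z
  rw [genMap_toGen] at hz
  obtain ⟨s, hts, hs⟩ := toGen_eq_zero 𝔞 hz
  obtain ⟨r, hsr, hr⟩ := exists_comap_pow_smul_top_le 𝔞 hf s
  have key : extMap N (indQuot 𝔞 f r) i (extQuotPowMap 𝔞 M N i t r (hts.trans hsr) e) = 0 := by
    have hcomp : quotPowMap 𝔞 M (hts.trans hsr) ∘ₗ indQuot 𝔞 f r =
        (quotPow 𝔞 f t ∘ₗ quotPowMap 𝔞 K hts) ∘ₗ Submodule.factor hr := by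
      ext; rfl
    rw [extQuotPowMap_eq, extMap_extMap, hcomp, ← extMap_extMap, ← extMap_extMap,
      ← extQuotPowMap_eq, hs, map_zero]
  obtain ⟨y, hy⟩ := exists_extMap_eq (indQuot_injective r) (quotPow_surjective hg r)
    (indQuot_exact_quotPow hg hfg r) _ key
  refine ⟨toGen 𝔞 N L i r y, ?_⟩
  rw [genMap_toGen, hy, toGen_extQuotPowMap]

/-- The kernel should be the image of H^(n-1)(K, N) under a connecting map. That map is not built on
the colimit: the stage maps γ to H^n(L, N) vanish where the comparison maps β to H^(n-1)(K, N) do.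
Once the ranges of β stabilize at T, the range of γ T contains the kernel. -/
lemma fg_ker_genMap [Module.Finite R N] (hf : Function.Injective f) (hg : Function.Surjective g)
    (hfg : Function.Exact f g) (n : ℕ)
    (hK : ∀ i < n, Module.Finite R (genLocalCohomology 𝔞 i K N)) :
    (LinearMap.ker (genMap 𝔞 N g n)).FG := by
  cases n with
  | zero =>
    have : LinearMap.ker (genMap 𝔞 N g 0) = ⊥ := by
      rw [eq_bot_iff]
      intro z hz
      obtain ⟨t, e, rfl⟩ := exists_toGen 𝔞 z
      rw [LinearMap.mem_ker, genMap_toGen] at hz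
      obtain ⟨s, hts, hs⟩ := toGen_eq_zero 𝔞 hz
      rw [extQuotPowMap_eq, extMap_extMap, quotPow_comp_quotPowMap, ← extMap_extMap,
        ← map_zero (extMap N (quotPow 𝔞 g s) 0)] at hs
      rw [Submodule.mem_bot, ← toGen_extQuotPowMap 𝔞 hts, extQuotPowMap_eq,
        extMap_zero_injective (quotPow_surjective hg s) hs, map_zero]
    rw [this]
    exact Submodule.fg_bot
  | succ m =>
    have hKm := hK m (Nat.lt_succ_self m)
    have hKfin : Module.Finite R K := Module.Finite.of_injective f hf
    let δ : ∀ t, Abelian.Ext (ModuleCat.of R (K ⧸ indFil 𝔞 f t)) (ModuleCat.of R N) m →ₗ[R]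
        extQuotPow 𝔞 L N (m + 1) t := fun t =>
      extConnecting N (indQuot_injective t) (quotPow_surjective hg t)
        (indQuot_exact_quotPow hg hfg t) m
    let γ := fun t => toGen 𝔞 N L (m + 1) t ∘ₗ δ t
    let β := fun t => toGen 𝔞 N K m t ∘ₗ extMap N (adicToInd 𝔞 f t) m
    have hγ : ∀ {s t} (h : s ≤ t) b, γ t (extMap N (indQuotMap h) m b) = γ s b := by
      intro s t h b
      have : δ t (extMap N (indQuotMap h) m b) = extQuotPowMap 𝔞 L N (m + 1) s t h (δ s b) :=
        extConnecting_extMap _ _ _ _ _ _ (indQuotMap h) (quotPowMap 𝔞 M h) (quotPowMap 𝔞 L h)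
          (by ext; rfl) (by ext; rfl) m b
      change toGen 𝔞 N L (m + 1) t (δ t _) = toGen 𝔞 N L (m + 1) s (δ s b)
      rw [this, toGen_extQuotPowMap]
    have hβ : ∀ {s t} (h : s ≤ t) b, β t (extMap N (indQuotMap h) m b) = β s b := by
      intro s t h b
      have : indQuotMap h ∘ₗ adicToInd 𝔞 f t = adicToInd 𝔞 f s ∘ₗ quotPowMap 𝔞 K h := by
        ext; rfl
      change toGen 𝔞 N K m t (extMap N _ m (extMap N _ m b)) = toGen 𝔞 N K m s (extMap N _ m b)
      rw [extMap_extMap, this, ← extMap_extMap, ← extQuotPowMap_eq, toGen_extQuotPowMap]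
    have hker : ∀ t b, β t b = 0 → γ t b = 0 := by
      intro t b hb
      change toGen 𝔞 N K m t (extMap N (adicToInd 𝔞 f t) m b) = 0 at hb
      obtain ⟨s, hts, hs⟩ := toGen_eq_zero 𝔞 hb
      rw [extQuotPowMap_eq] at hs
      obtain ⟨r, hsr, hr⟩ := exists_comap_pow_smul_top_le 𝔞 hf s
      have hcomp : indQuotMap (𝔞 := 𝔞) (f := f) (hts.trans hsr) =
          (adicToInd 𝔞 f t ∘ₗ quotPowMap 𝔞 K hts) ∘ₗ Submodule.factor hr := by
        ext; rfl
      rw [← hγ (hts.trans hsr), hcomp, ← extMap_extMap, ← extMap_extMap, hs,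
        map_zero, map_zero]
    obtain ⟨T, hT⟩ := monotone_stabilizes_iff_noetherian.2
      (inferInstance : IsNoetherian R (genLocalCohomology 𝔞 m K N))
      ⟨fun t => LinearMap.range (β t), by
        rintro s t h _ ⟨b, rfl⟩
        exact ⟨_, hβ h b⟩⟩
    have hBT := ModuleCat.finite_ext R (ModuleCat.of R (K ⧸ indFil 𝔞 f T)) (ModuleCat.of R N) m
    have hrfg : (LinearMap.range (γ T)).FG := by
      rw [LinearMap.range_eq_map]
      exact hBT.fg_top.map _
    refine Submodule.FG.of_le hrfg fun z hz => ?_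
    obtain ⟨t, e, rfl⟩ := exists_toGen 𝔞 z
    rw [LinearMap.mem_ker, genMap_toGen] at hz
    obtain ⟨s, hts, hs⟩ := toGen_eq_zero 𝔞 hz
    rw [extQuotPowMap_eq, extMap_extMap, quotPow_comp_quotPowMap, ← extMap_extMap,
      ← extQuotPowMap_eq] at hs
    obtain ⟨b, hb⟩ := exists_extConnecting_eq (indQuot_injective (𝔞 := 𝔞) (f := f) s)
      (quotPow_surjective hg s) (indQuot_exact_quotPow hg hfg s) _ hs
    rw [← toGen_extQuotPowMap 𝔞 hts, ← hb]
    have hrange : β (T + s) (extMap N (indQuotMap (Nat.le_add_left s T)) m b) ∈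
        LinearMap.range (β T) := by
      have := hT (T + s) (Nat.le_add_right T s)
      change LinearMap.range (β T) = LinearMap.range (β (T + s)) at this
      rw [this]
      exact ⟨_, rfl⟩
    obtain ⟨b', hb'⟩ := hrange
    refine ⟨b', ?_⟩
    change γ T b' = γ s b
    rw [← hγ (Nat.le_add_right T s), ← hγ (Nat.le_add_left s T), ← sub_eq_zero, ← map_sub]
    apply hker
    rw [map_sub, hβ, hb', sub_self]

lemma finite_genLocalCohomology_right [Module.Finite R N] (hf : Function.Injective f)
    (hg : Function.Surjective g) (hfg : Function.Exact f g) {n : ℕ}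
    (hK : ∀ i < n, Module.Finite R (genLocalCohomology 𝔞 i K N))
    (hM : ∀ i < n, Module.Finite R (genLocalCohomology 𝔞 i M N)) (i : ℕ) (hi : i < n) :
    Module.Finite R (genLocalCohomology 𝔞 i L N) := by
  have := hM i hi
  refine ⟨Submodule.fg_of_fg_map_of_fg_inf_ker (genMap 𝔞 N g i) (IsNoetherian.noetherian _) ?_⟩
  rw [top_inf_eq]
  exact fg_ker_genMap hf hg hfg i fun j hj => hK j (hj.trans hi)

/-- By exactness such an element lifts to some y in H^n(L, N), and 𝔞 y lies in the finitely
generated kernel of `genMap 𝔞 N g n`; so `fg_idealColon` applies. -/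
lemma fg_ker_genMap_inf_idealColon [Module.Finite R N] (hf : Function.Injective f)
    (hg : Function.Surjective g) (hfg : Function.Exact f g) {n : ℕ}
    (hK : ∀ i < n, Module.Finite R (genLocalCohomology 𝔞 i K N))
    (hL : (idealColon 𝔞 (⊥ : Submodule R (genLocalCohomology 𝔞 n L N))).FG) :
    (idealColon 𝔞 (⊥ : Submodule R (genLocalCohomology 𝔞 n M N)) ⊓
      LinearMap.ker (genMap 𝔞 N f n)).FG := by
  refine Submodule.FG.of_le
    ((fg_idealColon (fg_ker_genMap hf hg hfg n hK) hL).map (genMap 𝔞 N g n)) ?_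
  rintro z ⟨hz, hzf⟩
  obtain ⟨y, rfl⟩ := exists_genMap_eq hf hg hfg z hzf
  refine ⟨y, fun a ha => ?_, rfl⟩
  rw [LinearMap.mem_ker, map_smul]
  exact hz a ha

end LongExactSequence

/-! ### Finiteness of the 𝔞-socle by noetherian induction -/

section Socle

variable {R : Type u} [CommRing R] [IsNoetherianRing R] {𝔞 : Ideal R}

/-- Prime avoidance: otherwise 𝔞 lies in an associated prime Ann(m), and m is a nonzero element of
(0 : 𝔞). -/
lemma exists_mem_smul_injective {X : Type u} [AddCommGroup X] [Module R X] [Module.Finite R X]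
    (h : idealColon 𝔞 (⊥ : Submodule R X) = ⊥) :
    ∃ x ∈ 𝔞, Function.Injective (x • LinearMap.id : X →ₗ[R] X) := by
  rcases subsingleton_or_nontrivial X with hX | hX
  · exact ⟨0, 𝔞.zero_mem, Function.injective_of_subsingleton _⟩
  by_contra! hcon
  obtain ⟨p₀, hp₀⟩ := associatedPrimes.nonempty R X
  have hsub : (𝔞 : Set R) ⊆ ⋃ p ∈ associatedPrimes R X, p := by
    intro x hx
    rw [biUnion_associatedPrimes_eq_zero_divisors R X]
    by_contra hno
    refine hcon x hx ((injective_iff_map_eq_zero _).2 fun m hm => ?_)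
    by_contra hm0
    exact hno ⟨m, hm0, hm⟩
  obtain ⟨p, hp, hle⟩ := (Ideal.subset_union_prime_finite (associatedPrimes.finite R X)
    (f := fun p => p) p₀ p₀ fun p hp _ _ => IsAssociatedPrime.isPrime hp).1 hsub
  obtain ⟨hpp, m, hm⟩ := isAssociatedPrime_iff.1 hp
  have hmem : m ∈ idealColon 𝔞 (⊥ : Submodule R X) := fun a ha => by
    rw [← Submodule.mem_colon_singleton, ← hm]
    exact hle ha
  rw [h, Submodule.mem_bot] at hmem
  apply hpp.ne_top
  rw [hm, hmem, eq_top_iff]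
  intro r _
  simp

variable {N : Type u} [AddCommGroup N] [Module R N] [Module.Finite R N]
  {M : Type u} [AddCommGroup M] [Module R M] [Module.Finite R M]

lemma fg_idealColon_of_smul_eq_zero {K L : Type u} [AddCommGroup K] [Module R K]
    [AddCommGroup L] [Module R L] {f : K →ₗ[R] M} {g : M →ₗ[R] L} (hf : Function.Injective f)
    (hg : Function.Surjective g) (hfg : Function.Exact f g)
    (haK : ∀ a ∈ 𝔞, ∀ k : K, a • k = 0) {n : ℕ}
    (hM : ∀ i < n, Module.Finite R (genLocalCohomology 𝔞 i M N))
    (hL : (∀ i < n, Module.Finite R (genLocalCohomology 𝔞 i L N)) →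
      (idealColon 𝔞 (⊥ : Submodule R (genLocalCohomology 𝔞 n L N))).FG) :
    (idealColon 𝔞 (⊥ : Submodule R (genLocalCohomology 𝔞 n M N))).FG := by
  have hKfin : Module.Finite R K := Module.Finite.of_injective f hf
  have hK : ∀ i, Module.Finite R (genLocalCohomology 𝔞 i K N) :=
    finite_genLocalCohomology_of_smul_eq_zero 𝔞 haK
  have := hK n
  exact Submodule.fg_of_fg_map_of_fg_inf_ker (genMap 𝔞 N f n) (IsNoetherian.noetherian _)
    (fg_ker_genMap_inf_idealColon hf hg hfg (fun i _ => hK i)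
      (hL (finite_genLocalCohomology_right hf hg hfg (fun i _ => hK i) hM)))

/-- Here K = M, and the induced map is multiplication by x ∈ 𝔞, so the whole socle lies in its
kernel. -/
lemma fg_idealColon_of_smul_injective {L : Type u} [AddCommGroup L] [Module R L] {x : R}
    (hx : x ∈ 𝔞) {g : M →ₗ[R] L} (hf : Function.Injective (x • LinearMap.id : M →ₗ[R] M))
    (hg : Function.Surjective g) (hfg : Function.Exact (x • LinearMap.id : M →ₗ[R] M) g) {n : ℕ}
    (hM : ∀ i < n, Module.Finite R (genLocalCohomology 𝔞 i M N))
    (hL : (∀ i < n, Module.Finite R (genLocalCohomology 𝔞 i L N)) →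
      (idealColon 𝔞 (⊥ : Submodule R (genLocalCohomology 𝔞 n L N))).FG) :
    (idealColon 𝔞 (⊥ : Submodule R (genLocalCohomology 𝔞 n M N))).FG := by
  refine Submodule.FG.of_le (fg_ker_genMap_inf_idealColon hf hg hfg hM
    (hL (finite_genLocalCohomology_right hf hg hfg hM hM))) fun z hz => ⟨hz, ?_⟩
  exact LinearMap.mem_ker.2 ((genMap_smul_id 𝔞 x n z).trans (hz x hx))

lemma fg_idealColon_genLocalCohomology_quotient (U : Submodule R M) (n : ℕ)
    (hM : ∀ i < n, Module.Finite R (genLocalCohomology 𝔞 i (M ⧸ U) N)) :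
    (idealColon 𝔞 (⊥ : Submodule R (genLocalCohomology 𝔞 n (M ⧸ U) N))).FG := by
  induction U using WellFoundedGT.induction with
  | ind U ih =>
    have hlt : ∀ {K : Type u} [AddCommGroup K] [Module R K] (f : K →ₗ[R] M ⧸ U),
        LinearMap.range f ≠ ⊥ → U < (LinearMap.range f).comap U.mkQ := by
      intro K _ _ f hf
      refine lt_of_le_of_ne (U.le_comap_mkQ _) fun heq => hf ?_
      rw [← Submodule.map_comap_eq_of_surjective U.mkQ_surjective (LinearMap.range f), ← heq,
        Submodule.mkQ_map_self]
    -- In either case the cokernel is M/U' with U' > U, except when x is injective with zero range,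
    -- where M/U = 0.
    by_cases hsoc : idealColon 𝔞 (⊥ : Submodule R (M ⧸ U)) = ⊥
    · obtain ⟨x, hx, hinj⟩ := exists_mem_smul_injective hsoc
      by_cases hr : LinearMap.range (x • LinearMap.id : (M ⧸ U) →ₗ[R] (M ⧸ U)) = ⊥
      · have := finite_genLocalCohomology_of_smul_eq_zero (N := N) 𝔞 (K := M ⧸ U) (fun a _ m => by
          have hm : (x • LinearMap.id : (M ⧸ U) →ₗ[R] (M ⧸ U)) m = 0 := by
            rw [LinearMap.range_eq_bot.1 hr, LinearMap.zero_apply]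
          rw [(map_eq_zero_iff _ hinj).1 hm, smul_zero]) n
        exact IsNoetherian.noetherian _
      · exact fg_idealColon_of_smul_injective hx hinj (Submodule.factor_surjective _)
          (exact_factor_comap_mkQ _) hM (ih _ (hlt _ hr))
    · refine fg_idealColon_of_smul_eq_zero (Submodule.injective_subtype _)
        (Submodule.factor_surjective _)
        (exact_factor_comap_mkQ (idealColon 𝔞 (⊥ : Submodule R (M ⧸ U))).subtype)
        (fun a ha k => Subtype.ext (k.2 a ha)) hM (ih _ (hlt _ ?_))
      rwa [Submodule.range_subtype]

/-- If `H^i_𝔞(M, N)` is finitely generated for all `i < n`, then the submodule of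
`H^n_𝔞(M, N)` killed by `𝔞` is finitely generated. -/
theorem fg_idealColon_genLocalCohomology (n : ℕ)
    (hM : ∀ i < n, Module.Finite R (genLocalCohomology 𝔞 i M N)) :
    (idealColon 𝔞 (⊥ : Submodule R (genLocalCohomology 𝔞 n M N))).FG :=
  -- The sequence 0 → ⊥ → M → M/⊥ → 0 carries the result from M/⊥ back to M.
  fg_idealColon_of_smul_eq_zero (f := (⊥ : Submodule R M).subtype)
    (Submodule.injective_subtype _) (Submodule.mkQ_surjective ⊥)
    (LinearMap.exact_subtype_mkQ ⊥)
    (fun _ _ _ => Subsingleton.elim _ _) hM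
    (fg_idealColon_genLocalCohomology_quotient ⊥ n)

end Socle

end GenLocalCohomology

end

theorem theorem2p1 {R : Type u} [CommRing R] [IsNoetherianRing R] (𝔞 : Ideal R)
    (M N : Type u) [AddCommGroup M] [Module R M] [Module.Finite R M]
    [AddCommGroup N] [Module R N] [Module.Finite R N] (n : ℕ) :
    List.TFAE [
      ∀ i < n, GenLocalCohomology.IsCoatomicModule R
        (GenLocalCohomology.genLocalCohomology 𝔞 i M N),
      ∀ i < n, GenLocalCohomology.coass R (GenLocalCohomology.genLocalCohomology 𝔞 i M N) ⊆
        PrimeSpectrum.zeroLocus (𝔞 : Set R),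
      ∀ i < n, Module.Finite R (GenLocalCohomology.genLocalCohomology 𝔞 i M N)] := by
  open GenLocalCohomology in
  tfae_have 3 → 1 := fun h i hi =>
    have := h i hi
    isCoatomicModule_of_finite
  tfae_have 3 → 2 := fun h i hi =>
    have := h i hi
    coass_subset_of_finite (genLocalCohomology_torsion 𝔞)
  tfae_have 1 → 3 := fun h i => by
    induction i using Nat.strong_induction_on with
    | _ i ih =>
      intro hi
      exact finite_of_isCoatomicModule (genLocalCohomology_torsion 𝔞)
        (fg_idealColon_genLocalCohomology i fun j hj => ih j hj (hj.trans hi)) (h i hi)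
  tfae_have 2 → 3 := fun h i => by
    induction i using Nat.strong_induction_on with
    | _ i ih =>
      intro hi
      exact finite_of_coass_subset (genLocalCohomology_torsion 𝔞)
        (fg_idealColon_genLocalCohomology i fun j hj => ih j hj (hj.trans hi)) (h i hi)
  tfae_finish
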